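/- Theorem (Necessary optimality condition). Let $p,q,m,r$ be integers with $m\ge 0$ and $1\le r<\min\{p,q\}$, let $\beta>0$, and let $A_1,\dots,A_m\in\mathbb{R}^{(p+1)\times q}$ (for training data $X_i\in\mathbb{R}^{p\times q}$, $y_i\in\{-1,1\}$ and a standard basis vector $e_j\in\mathbb{R}^q$, these are $A_i=-y_i\begin{bmatrix}X_i\\ e_j^\top\end{bmatrix}$). With $\langle W,Y\rangle=\operatorname{tr}(W^\top Y)$, put $\mathscr{A}(\hat W)=(\langle A_1,\hat W\rangle,\dots,\langle A_m,\hat W\rangle)^\top$, let $\|z_+\|_0$ be the number of positive entries of $z\in\mathbb{R}^m$, and consider $$\min_{\hat W\in\mathbb{R}^{(p+1)\times q},\,z\in\mathbb{R}^m}\ \tfrac12\langle\hat W,\hat W\rangle+\beta\|z_+\|_0\quad\text{s.t.}\quad \mathbf 1+\mathscr{A}(\hat W)=z,\quad \operatorname{rank}(\hat W)\le r,\qquad (\ast)$$ with feasible region $\mathcal F$ and Lagrangian $\mathscr L(\hat W,z,\lambda)=\tfrac12\langle\hat W,\hat W\rangle+\beta\|z_+\|_0+\langle\lambda,\mathbf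 1+\mathscr A(\hat W)-z\rangle$, $\lambda\in\mathbb{R}^m$. On $\mathbb{R}^{(p+1)\times q}\times\mathbb{R}^m$ with its Euclidean inner product, the regular subdifferential $\partial g(x)$ of a real-valued function $g$ is the set of $v$ with $g(y)\ge g(x)+\langle v,y-x\rangle-o(\|y-x\|)$ as $y\to x$, and the regular normal cone $\mathrm N_S(x)$ of a set $S$ at $x\in S$ is the set of $v$ with $\langle v,y-x\rangle\le o(\|y-x\|)$ as $y\to x$, $y\in S$. A point $(\hat W,z)$ is a KKT point of $(\ast)$ if there is $\lambda\in\mathbb{R}^m$ such that $$-\partial_{(\hat W,z)}\mathscr L(\hat W,z,\lambda)\cap\mathrm N_{\mathcal F}(\hat W,z)\neq\emptyset,\qquad \operatorname{rank}(\hat W)\le r,\qquad \mathbf 1+\mathscr A(\hat W)-z=0.$$ Let $(\hat W,z)$ be a local minimizer of $(\ast)$, and let $\hat W=U\Sigma V^\top$ be a singular value decomposition with $U\in\mathbb{R}^{(p+1)\times(p+1)}$ and $V\in\mathbb{R}^{q\times q}$ orthogonal. Let $\Gamma$ be the index set of the nonzero singular values, let $\Gamma_p^\perp=\{1,\dots,p+1\}\setminus\Gamma$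 and $\Gamma_q^\perp=\{1,\dots,q\}\setminus\Gamma$, and let $U_I,V_I$ denote the submatrices of the columns indexed by $I$. For $i=1,\dots,m$ put $$T^i=\begin{bmatrix}U_\Gamma^\top A_iV_\Gamma & U_\Gamma^\top A_iV_{\Gamma_q^\perp}\\ U_{\Gamma_p^\perp}^\top A_iV_\Gamma & O\end{bmatrix},\qquad R^i=U^\top A_iV_\Gamma .$$ Assume that $T^1,\dots,T^m$ are linearly independent if $\operatorname{rank}(\hat W)=r$, and that $R^1,\dots,R^m$ are linearly independent if $\operatorname{rank}(\hat W)<r$. Then $(\hat W,z)$ is a KKT point of $(\ast)$. -/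

import Mathlib

open scoped Topology

namespace HLSMM

/-- Frobenius inner product `⟨W, Y⟩ = tr (Wᵀ Y)`. -/
noncomputable def frobInner {n q : ℕ} (W Y : Matrix (Fin n) (Fin q) ℝ) : ℝ :=
  (W.transpose * Y).trace

/-- The linear operator `𝒜(W) = (⟨A₁, W⟩, …, ⟨Aₘ, W⟩)`. -/
noncomputable def opA {n q m : ℕ} (A : Fin m → Matrix (Fin n) (Fin q) ℝ)
    (W : Matrix (Fin n) (Fin q) ℝ) : Fin m → ℝ :=
  fun i => frobInner (A i) W

/-- The scalar loss: `1` at positive arguments, `0` elsewhere. -/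
noncomputable def ell01 (t : ℝ) : ℝ := if 0 < t then 1 else 0

/-- The Heaviside loss `‖z₊‖₀`, the number of positive entries of `z`. -/
noncomputable def heavisideLoss {m : ℕ} (z : Fin m → ℝ) : ℝ := ∑ i, ell01 (z i)

/-- The space of pairs `(W, z)`; its (product) topology is the Euclidean one. -/
abbrev Pt (n q m : ℕ) : Type := Matrix (Fin n) (Fin q) ℝ × (Fin m → ℝ)

/-- The Euclidean inner product `⟨W, W'⟩ + ⟨z, z'⟩` on pairs. -/
noncomputable def pairInner {n q m : ℕ} (x y : Pt n q m) : ℝ :=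
  frobInner x.1 y.1 + x.2 ⬝ᵥ y.2

/-- The Euclidean norm on pairs. -/
noncomputable def pairNorm {n q m : ℕ} (x : Pt n q m) : ℝ := Real.sqrt (pairInner x x)

/-- The affine set `ℒ = {(W, z) | 1 + 𝒜(W) = z}`. -/
def affineSet {n q m : ℕ} (A : Fin m → Matrix (Fin n) (Fin q) ℝ) : Set (Pt n q m) :=
  {x | 1 + opA A x.1 = x.2}

/-- The set `ℛ = {W | rank W ≤ r}`. -/
def rankSet (n q r : ℕ) : Set (Matrix (Fin n) (Fin q) ℝ) := {W | W.rank ≤ r}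

/-- The feasible region `ℱ = ℒ ∩ ℛ`, where `ℛ` constrains the matrix component. -/
def feasibleSet {n q m : ℕ} (A : Fin m → Matrix (Fin n) (Fin q) ℝ) (r : ℕ) : Set (Pt n q m) :=
  affineSet A ∩ {x | x.1 ∈ rankSet n q r}

/-- The objective `½⟨W, W⟩ + β‖z₊‖₀`. -/
noncomputable def objective {n q m : ℕ} (β : ℝ) (x : Pt n q m) : ℝ :=
  (1 / 2) * frobInner x.1 x.1 + β * heavisideLoss x.2

/-- Local minimizers of `½⟨W, W⟩ + β‖z₊‖₀` subject to `1 + 𝒜(W) = z` and `rank W ≤ r`. -/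
def IsLocalMinimizer {n q m : ℕ} (A : Fin m → Matrix (Fin n) (Fin q) ℝ) (β : ℝ) (r : ℕ)
    (x : Pt n q m) : Prop :=
  x ∈ feasibleSet A r ∧ IsLocalMinOn (objective β) (feasibleSet A r) x

/-- The Lagrangian `½⟨W, W⟩ + β‖z₊‖₀ + ⟨lam, 1 + 𝒜(W) - z⟩`. -/
noncomputable def lagrangian {n q m : ℕ} (A : Fin m → Matrix (Fin n) (Fin q) ℝ) (β : ℝ)
    (lam : Fin m → ℝ) (x : Pt n q m) : ℝ :=
  (1 / 2) * frobInner x.1 x.1 + β * heavisideLoss x.2 + lam ⬝ᵥ (1 + opA A x.1 - x.2)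

/-- The regular (Fréchet) subdifferential of `g` at `x`: all `v` with
`g y ≥ g x + ⟨v, y - x⟩ - o(‖y - x‖)` as `y → x`. -/
def regularSubdifferential {n q m : ℕ} (g : Pt n q m → ℝ) (x : Pt n q m) : Set (Pt n q m) :=
  {v | ∀ ε : ℝ, 0 < ε →
    ∀ᶠ y in 𝓝 x, g x + pairInner v (y - x) - ε * pairNorm (y - x) ≤ g y}

/-- The regular (Fréchet) normal cone to `S` at `x ∈ S`: all `v` with
`⟨v, y - x⟩ ≤ o(‖y - x‖)` as `y → x` in `S`; it is empty when `x ∉ S`. -/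
def regularNormalCone {n q m : ℕ} (S : Set (Pt n q m)) (x : Pt n q m) : Set (Pt n q m) :=
  {v | x ∈ S ∧ ∀ ε : ℝ, 0 < ε →
    ∀ᶠ y in 𝓝[S] x, pairInner v (y - x) ≤ ε * pairNorm (y - x)}

/-- KKT points: for some multiplier, minus a regular subgradient of the Lagrangian in `(W, z)`
lies in the regular normal cone of the feasible region, and the point is feasible. -/
def IsKKTPoint {n q m : ℕ} (A : Fin m → Matrix (Fin n) (Fin q) ℝ) (β : ℝ) (r : ℕ)
    (x : Pt n q m) : Prop :=
  ∃ lam : Fin m → ℝ,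
    (∃ v ∈ regularSubdifferential (lagrangian A β lam) x,
      -v ∈ regularNormalCone (feasibleSet A r) x) ∧
    x.1.rank ≤ r ∧
    1 + opA A x.1 - x.2 = 0

/-- The rectangular `n × q` diagonal matrix with diagonal `σ`. -/
def rectDiagonal {n q : ℕ} (σ : Fin (min n q) → ℝ) : Matrix (Fin n) (Fin q) ℝ :=
  Matrix.of fun i j =>
    if h : (i : ℕ) = (j : ℕ) then
      σ ⟨(i : ℕ), lt_min i.isLt (lt_of_eq_of_lt h j.isLt)⟩
    else 0

/-- `W = U Σ Vᵀ` is a singular value decomposition: `U`, `V` orthogonal, `Σ` rectangular diagonal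
with nonnegative nonincreasing diagonal `σ`. -/
structure IsSVD {n q : ℕ} (W : Matrix (Fin n) (Fin q) ℝ) (U : Matrix (Fin n) (Fin n) ℝ)
    (σ : Fin (min n q) → ℝ) (V : Matrix (Fin q) (Fin q) ℝ) : Prop where
  orthogonal_left : U ∈ Matrix.orthogonalGroup (Fin n) ℝ
  orthogonal_right : V ∈ Matrix.orthogonalGroup (Fin q) ℝ
  nonneg : ∀ k, 0 ≤ σ k
  antitone : Antitone σ
  eq_mul : W = U * rectDiagonal σ * V.transpose

/-- The index set `Γ` of the nonzero singular values. -/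
abbrev Gam {n q : ℕ} (σ : Fin (min n q) → ℝ) : Type := {k : Fin (min n q) // σ k ≠ 0}

/-- The complement of `Γ` among the `n` row indices. -/
abbrev GamRowCompl {n q : ℕ} (σ : Fin (min n q) → ℝ) : Type :=
  {i : Fin n // ∀ k : Gam σ, Fin.castLE (min_le_left n q) k.1 ≠ i}

/-- The complement of `Γ` among the `q` column indices. -/
abbrev GamColCompl {n q : ℕ} (σ : Fin (min n q) → ℝ) : Type :=
  {j : Fin q // ∀ k : Gam σ, Fin.castLE (min_le_right n q) k.1 ≠ j}

/-- The columns of `U` indexed by `Γ`. -/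
def leftGam {n q : ℕ} (U : Matrix (Fin n) (Fin n) ℝ) (σ : Fin (min n q) → ℝ) :
    Matrix (Fin n) (Gam σ) ℝ :=
  U.submatrix id fun k => Fin.castLE (min_le_left n q) k.1

/-- The columns of `U` indexed by the complement of `Γ`. -/
def leftCompl {n q : ℕ} (U : Matrix (Fin n) (Fin n) ℝ) (σ : Fin (min n q) → ℝ) :
    Matrix (Fin n) (GamRowCompl σ) ℝ :=
  U.submatrix id fun i => i.1

/-- The columns of `V` indexed by `Γ`. -/
def rightGam {n q : ℕ} (V : Matrix (Fin q) (Fin q) ℝ) (σ : Fin (min n q) → ℝ) :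
    Matrix (Fin q) (Gam σ) ℝ :=
  V.submatrix id fun k => Fin.castLE (min_le_right n q) k.1

/-- The columns of `V` indexed by the complement of `Γ`. -/
def rightCompl {n q : ℕ} (V : Matrix (Fin q) (Fin q) ℝ) (σ : Fin (min n q) → ℝ) :
    Matrix (Fin q) (GamColCompl σ) ℝ :=
  V.submatrix id fun j => j.1

/-- The block matrix `T = [U_Γᵀ A V_Γ, U_Γᵀ A V_Γ⊥; U_Γ⊥ᵀ A V_Γ, 0]`. -/
noncomputable def matT {n q : ℕ} (U : Matrix (Fin n) (Fin n) ℝ) (σ : Fin (min n q) → ℝ)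
    (V : Matrix (Fin q) (Fin q) ℝ) (A : Matrix (Fin n) (Fin q) ℝ) :
    Matrix (Gam σ ⊕ GamRowCompl σ) (Gam σ ⊕ GamColCompl σ) ℝ :=
  Matrix.fromBlocks
    ((leftGam U σ).transpose * A * rightGam V σ)
    ((leftGam U σ).transpose * A * rightCompl V σ)
    ((leftCompl U σ).transpose * A * rightGam V σ)
    0

/-- The matrix `R = Uᵀ A V_Γ`. -/
noncomputable def matR {n q : ℕ} (U : Matrix (Fin n) (Fin n) ℝ) (σ : Fin (min n q) → ℝ)
    (V : Matrix (Fin q) (Fin q) ℝ) (A : Matrix (Fin n) (Fin q) ℝ) :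
    Matrix (Fin n) (Gam σ) ℝ :=
  U.transpose * A * rightGam V σ

/-- The constraint qualification at `W`, expressed through a singular value decomposition of `W`:
the `T` matrices are linearly independent if `rank W = r`, the `R` matrices if `rank W < r`. -/
def ConstraintQualification {n q m : ℕ} (A : Fin m → Matrix (Fin n) (Fin q) ℝ) (r : ℕ)
    (W : Matrix (Fin n) (Fin q) ℝ) (U : Matrix (Fin n) (Fin n) ℝ)
    (σ : Fin (min n q) → ℝ) (V : Matrix (Fin q) (Fin q) ℝ) : Prop :=
  (W.rank = r → LinearIndependent ℝ fun i => matT U σ V (A i)) ∧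
  (W.rank < r → LinearIndependent ℝ fun i => matR U σ V (A i))

end HLSMM

/-! The loss $\beta\|z_+\|_0$ is locally constant except across zeros of $z$, where it jumps up by
$\beta$. A feasible curve from $W$ with velocity $H$ and $\langle A_i,H\rangle<0$ whenever $z_i=0$
does not raise the loss, so minimality forces $\langle W,H\rangle\ge 0$
(`IsLocalMinimizer.frobInner_nonneg_of_neg`). On a subspace $S$ of such velocities where the
$\langle A_i,\cdot\rangle$ are independent, a dual family $h_j$ extends this to $\langle
A_i,H\rangle\le 0$ and gives the multipliers $s_j=-\langle W,h_j\rangle$ explicitly: $s\ge 0$,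
$s_i=0$ where $z_i\ne 0$, and $W+\sum_i s_iA_i\perp S$ (`IsLocalMinimizer.exists_multiplier`).

Such an $s$ is a regular subgradient of the loss, and it cancels the $-s$ contributed by the
multiplier term. Hence $(W+\sum_i s_iA_i,0)$ is a regular subgradient of the Lagrangian, and it
remains to see that $N=-(W+\sum_i s_iA_i)$ is normal to the rank set (`isKKTPoint_of_multiplier`).

If $\operatorname{rank} W=r$, take $S=\{XW+WY\}$. Orthogonality to $S$ means $NW^\top=0$ and $W^\top
N=0$, which implies normality by `eventually_frobInner_sub_le`; independence on $S$ follows from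
that of the $T^i$. If $\operatorname{rank} W<r$, independence of the $R^i$ already determines $s$
from $\{XW\}$. Any rank-one direction may be adjoined without changing $s$, so $N=0$. -/

namespace HLSMM

/-! ### Frobenius inner product. -/

section FrobeniusInner

variable {n q k : ℕ}

theorem frobInner_eq_sum (W Y : Matrix (Fin n) (Fin q) ℝ) :
    frobInner W Y = ∑ i, ∑ j, W i j * Y i j := by
  simp only [frobInner, Matrix.trace, Matrix.diag, Matrix.mul_apply, Matrix.transpose_apply]
  exact Finset.sum_comm

theorem frobInner_comm (W Y : Matrix (Fin n) (Fin q) ℝ) : frobInner W Y = frobInner Y W := by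
  simp only [frobInner_eq_sum, mul_comm]

theorem frobInner_add_right (W X Y : Matrix (Fin n) (Fin q) ℝ) :
    frobInner W (X + Y) = frobInner W X + frobInner W Y := by
  simp [frobInner, Matrix.mul_add]

theorem frobInner_smul_right (W X : Matrix (Fin n) (Fin q) ℝ) (t : ℝ) :
    frobInner W (t • X) = t * frobInner W X := by
  simp [frobInner]

/-- The functional `⟨W, ·⟩`. -/
noncomputable def frobLin (W : Matrix (Fin n) (Fin q) ℝ) : Matrix (Fin n) (Fin q) ℝ →ₗ[ℝ] ℝ where
  toFun := frobInner W
  map_add' := frobInner_add_right W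
  map_smul' t X := frobInner_smul_right W X t

theorem frobInner_sub_right (W X Y : Matrix (Fin n) (Fin q) ℝ) :
    frobInner W (X - Y) = frobInner W X - frobInner W Y := map_sub (frobLin W) X Y

theorem frobInner_neg_right (W X : Matrix (Fin n) (Fin q) ℝ) :
    frobInner W (-X) = -frobInner W X := map_neg (frobLin W) X

theorem frobInner_sum_right {ι : Type*} (s : Finset ι) (W : Matrix (Fin n) (Fin q) ℝ)
    (X : ι → Matrix (Fin n) (Fin q) ℝ) :
    frobInner W (∑ i ∈ s, X i) = ∑ i ∈ s, frobInner W (X i) := map_sum (frobLin W) X s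

theorem frobInner_add_left (W X Y : Matrix (Fin n) (Fin q) ℝ) :
    frobInner (X + Y) W = frobInner X W + frobInner Y W := by
  simp [frobInner, Matrix.add_mul]

theorem frobInner_smul_left (W X : Matrix (Fin n) (Fin q) ℝ) (t : ℝ) :
    frobInner (t • X) W = t * frobInner X W := by
  simp [frobInner]

theorem frobInner_neg_left (W X : Matrix (Fin n) (Fin q) ℝ) :
    frobInner (-X) W = -frobInner X W := by
  rw [frobInner_comm, frobInner_neg_right, frobInner_comm]

theorem frobInner_sum_left {ι : Type*} (s : Finset ι) (W : Matrix (Fin n) (Fin q) ℝ)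
    (X : ι → Matrix (Fin n) (Fin q) ℝ) :
    frobInner (∑ i ∈ s, X i) W = ∑ i ∈ s, frobInner (X i) W := by
  simp only [frobInner_comm _ W, frobInner_sum_right]

theorem frobInner_self_nonneg (W : Matrix (Fin n) (Fin q) ℝ) : 0 ≤ frobInner W W := by
  rw [frobInner_eq_sum]
  exact Finset.sum_nonneg fun i _ => Finset.sum_nonneg fun j _ => mul_self_nonneg _

theorem frobInner_single_right (W : Matrix (Fin n) (Fin q) ℝ) (i : Fin n) (j : Fin q) :
    frobInner W (Matrix.single i j 1) = W i j := by
  simp [frobInner_eq_sum, Matrix.single_apply, ite_and]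

theorem eq_zero_of_forall_frobInner_eq_zero {W : Matrix (Fin n) (Fin q) ℝ}
    (h : ∀ X, frobInner W X = 0) : W = 0 := by
  ext i j
  simpa [frobInner_single_right] using h (Matrix.single i j 1)

theorem frobInner_mul_right (B : Matrix (Fin n) (Fin q) ℝ) (X : Matrix (Fin n) (Fin k) ℝ)
    (Y : Matrix (Fin k) (Fin q) ℝ) :
    frobInner B (X * Y) = frobInner (B * Y.transpose) X := by
  simp only [frobInner, Matrix.transpose_mul, Matrix.transpose_transpose]
  rw [← Matrix.mul_assoc, Matrix.trace_mul_comm, ← Matrix.mul_assoc]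

theorem frobInner_mul_right' (B : Matrix (Fin n) (Fin q) ℝ) (X : Matrix (Fin n) (Fin k) ℝ)
    (Y : Matrix (Fin k) (Fin q) ℝ) :
    frobInner B (X * Y) = frobInner (X.transpose * B) Y := by
  simp only [frobInner, Matrix.transpose_mul, Matrix.transpose_transpose, Matrix.mul_assoc]

theorem frobInner_le_sqrt_mul_sqrt (W Y : Matrix (Fin n) (Fin q) ℝ) :
    frobInner W Y ≤ √(frobInner W W) * √(frobInner Y Y) := by
  simp only [frobInner_eq_sum, ← Fintype.sum_prod_type', ← pow_two]
  exact Real.sum_mul_le_sqrt_mul_sqrt _ _ _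

theorem continuous_frobInner {α : Type*} [TopologicalSpace α]
    {f g : α → Matrix (Fin n) (Fin q) ℝ} (hf : Continuous f) (hg : Continuous g) :
    Continuous fun a => frobInner (f a) (g a) := by
  unfold frobInner
  exact (hf.matrix_transpose.matrix_mul hg).matrix_trace

theorem continuous_opA {m : ℕ} (A : Fin m → Matrix (Fin n) (Fin q) ℝ) : Continuous (opA A) :=
  continuous_pi fun _ => continuous_frobInner continuous_const continuous_id

theorem sqrt_frobInner_le_pairNorm {m : ℕ} (x : Pt n q m) :
    √(frobInner x.1 x.1) ≤ pairNorm x := by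
  refine Real.sqrt_le_sqrt ?_
  have : 0 ≤ x.2 ⬝ᵥ x.2 := Finset.sum_nonneg fun i _ => mul_self_nonneg _
  simpa [pairInner] using this

end FrobeniusInner

/-! ### First-order conditions and multipliers. -/

section FirstOrder

variable {n q m r : ℕ} {A : Fin m → Matrix (Fin n) (Fin q) ℝ} {β : ℝ}
  {W : Matrix (Fin n) (Fin q) ℝ} {z : Fin m → ℝ}

theorem ell01_le_one (t : ℝ) : ell01 t ≤ 1 := by
  unfold ell01; split_ifs <;> norm_num

theorem ell01_of_pos {t : ℝ} (h : 0 < t) : ell01 t = 1 := if_pos h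

theorem ell01_of_nonpos {t : ℝ} (h : t ≤ 0) : ell01 t = 0 := if_neg h.not_gt

/-- First-order necessary condition along a quadratic curve in the rank set on which the active
constraints strictly decrease. -/
theorem IsLocalMinimizer.frobInner_nonneg_of_neg (hβ : 0 < β)
    (hmin : IsLocalMinimizer A β r (W, z)) (H Q : Matrix (Fin n) (Fin q) ℝ)
    (hrank : ∀ t : ℝ, (W + t • H + t ^ 2 • Q).rank ≤ r)
    (hneg : ∀ i, z i = 0 → frobInner (A i) H < 0) : 0 ≤ frobInner W H := by
  obtain ⟨⟨hz, -⟩, hloc⟩ := hmin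
  have hz : 1 + opA A W = z := hz
  set w : ℝ → Matrix (Fin n) (Fin q) ℝ := fun t => W + t • H + t ^ 2 • Q with hw
  have hwc : Continuous w := by fun_prop
  have hw0 : w 0 = W := by simp [hw]
  set γ : ℝ → Pt n q m := fun t => (w t, 1 + opA A (w t)) with hγ
  have hγc : Continuous γ := hwc.prodMk (continuous_const.add ((continuous_opA A).comp hwc))
  have hγ0 : γ 0 = (W, z) := by simp [hγ, hw0, hz]
  have hγmem : ∀ t, γ t ∈ feasibleSet A r := fun t => ⟨rfl, hrank t⟩
  have hobj : ∀ᶠ t in 𝓝[>] (0 : ℝ), objective β (W, z) ≤ objective β (γ t) := by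
    have h1 : Filter.Tendsto γ (𝓝[>] 0) (𝓝[feasibleSet A r] (W, z)) := by
      refine tendsto_nhdsWithin_iff.2 ⟨?_, .of_forall hγmem⟩
      rw [← hγ0]
      exact hγc.continuousAt.tendsto.mono_left nhdsWithin_le_nhds
    exact h1.eventually hloc
  have hell : ∀ᶠ t in 𝓝[>] (0 : ℝ), ∀ i, ell01 ((γ t).2 i) ≤ ell01 (z i) := by
    refine Filter.eventually_all.2 fun i => ?_
    have hexp : ∀ t, (γ t).2 i =
        z i + t * (frobInner (A i) H + t * frobInner (A i) Q) := by
      intro t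
      simp only [hγ, hw, ← hz, opA, Pi.add_apply, frobInner_add_right, frobInner_smul_right]
      ring
    -- Negative entries stay negative by continuity, zero entries are pushed down because the strict
    -- linear term outweighs the quadratic one, and positive entries already incur the maximal loss.
    rcases lt_trichotomy (z i) 0 with h | h | h
    · have hc : Continuous fun t => (γ t).2 i := (continuous_apply i).comp hγc.snd
      have : ∀ᶠ t in 𝓝 (0 : ℝ), (γ t).2 i < 0 := by
        refine hc.continuousAt.eventually_lt continuousAt_const ?_
        simpa [hγ0] using h
      filter_upwards [nhdsWithin_le_nhds this] with t ht
      rw [ell01_of_nonpos ht.le, ell01_of_nonpos h.le]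
    · have hc : Continuous fun t : ℝ => frobInner (A i) H + t * frobInner (A i) Q := by fun_prop
      have : ∀ᶠ t in 𝓝 (0 : ℝ), frobInner (A i) H + t * frobInner (A i) Q < 0 := by
        refine hc.continuousAt.eventually_lt continuousAt_const ?_
        simpa using hneg i h
      filter_upwards [nhdsWithin_le_nhds this, self_mem_nhdsWithin] with t ht ht0
      rw [hexp, h, zero_add, ell01_of_nonpos (mul_neg_of_pos_of_neg ht0 ht).le,
        ell01_of_nonpos le_rfl]
    · rw [ell01_of_pos h]
      exact .of_forall fun t => ell01_le_one _
  have hquot : ∀ᶠ t in 𝓝[>] (0 : ℝ), 0 ≤ frobInner W H +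
      t * (frobInner H H / 2 + frobInner W Q + t * frobInner H Q + t ^ 2 * frobInner Q Q / 2) := by
    filter_upwards [hobj, hell, self_mem_nhdsWithin] with t h1 h2 (ht : 0 < t)
    have h3 : heavisideLoss (γ t).2 ≤ heavisideLoss z := Finset.sum_le_sum fun i _ => h2 i
    have h4 : frobInner W W ≤ frobInner (w t) (w t) := by
      have := mul_le_mul_of_nonneg_left h3 hβ.le
      simp only [objective] at h1
      change _ ≤ 1 / 2 * frobInner (w t) (w t) + _ at h1
      linarith
    refine nonneg_of_mul_nonneg_right (a := t) ?_ ht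
    simp only [hw, frobInner_add_right, frobInner_smul_right, frobInner_add_left,
      frobInner_smul_left, frobInner_comm H W, frobInner_comm Q W, frobInner_comm Q H] at h4
    linarith
  refine ge_of_tendsto ?_ hquot
  have hc : Continuous fun t : ℝ => frobInner W H +
      t * (frobInner H H / 2 + frobInner W Q + t * frobInner H Q + t ^ 2 * frobInner Q Q / 2) := by
    fun_prop
  simpa using hc.continuousAt.tendsto.mono_left (nhdsWithin_le_nhds (a := 0) (s := Set.Ioi 0))

/-- If the `⟨A i, ·⟩` are independent on a subspace, they have a dual family there. -/
theorem exists_dual_family (A : Fin m → Matrix (Fin n) (Fin q) ℝ)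
    (S : Submodule ℝ (Matrix (Fin n) (Fin q) ℝ))
    (hind : ∀ c : Fin m → ℝ, (∀ H ∈ S, frobInner (∑ i, c i • A i) H = 0) → c = 0) :
    ∃ h : Fin m → Matrix (Fin n) (Fin q) ℝ,
      (∀ i, h i ∈ S) ∧ ∀ i j, frobInner (A i) (h j) = if i = j then 1 else 0 := by
  classical
  let L : S →ₗ[ℝ] (Fin m → ℝ) := (LinearMap.pi fun i => frobLin (A i)).comp S.subtype
  -- Were the range proper, a nonzero functional would vanish on it; its coefficients would form a
  -- combination of the `A i` orthogonal to `S`, contradicting `hind`.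
  have hL : LinearMap.range L = ⊤ := by
    by_contra hne
    obtain ⟨f, hf0, hf⟩ := Submodule.exists_le_ker_of_lt_top _ (lt_top_iff_ne_top.2 hne)
    refine hf0 ?_
    have hc := hind (fun i => f (Pi.single i 1)) fun H hH => ?_
    · refine LinearMap.pi_ext' fun i => LinearMap.ext_ring ?_
      simpa using congrFun hc i
    · have : f (L ⟨H, hH⟩) = 0 := hf ⟨_, rfl⟩
      rw [← this, LinearMap.pi_apply_eq_sum_univ f, frobInner_sum_left]
      refine Finset.sum_congr rfl fun i _ => ?_
      rw [frobInner_smul_left, mul_comm, smul_eq_mul]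
      congr 2
      ext j
      simp [Pi.single_apply, eq_comm]
  choose h hh using fun j => LinearMap.range_eq_top.1 hL (Pi.single j 1)
  refine ⟨fun j => h j, fun j => (h j).2, fun i j => ?_⟩
  have : frobInner (A i) (h j) = Pi.single (M := fun _ => ℝ) j 1 i := congrFun (hh j) i
  rw [this, Pi.single_apply]

/-- Lagrange multipliers on a subspace of directions tangent to the rank set. -/
theorem IsLocalMinimizer.exists_multiplier (hβ : 0 < β)
    (hmin : IsLocalMinimizer A β r (W, z)) (S : Submodule ℝ (Matrix (Fin n) (Fin q) ℝ))
    (hS : ∀ H ∈ S, ∃ Q, ∀ t : ℝ, (W + t • H + t ^ 2 • Q).rank ≤ r)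
    (hind : ∀ c : Fin m → ℝ, (∀ H ∈ S, frobInner (∑ i, c i • A i) H = 0) → c = 0) :
    ∃ s : Fin m → ℝ, (∀ i, 0 ≤ s i) ∧ (∀ i, z i ≠ 0 → s i = 0) ∧
      ∀ H ∈ S, frobInner (W + ∑ i, s i • A i) H = 0 := by
  classical
  obtain ⟨h, hhS, hh⟩ := exists_dual_family A S hind
  have hfirst : ∀ H ∈ S, (∀ i, z i = 0 → frobInner (A i) H ≤ 0) → 0 ≤ frobInner W H := by
    intro H hH hle
    -- Since $\langle A_i,\sum_j h_j\rangle=1$ for every $i$, subtracting $\delta\sum_j h_j$ turns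
    -- the weak inequalities into strict ones; then $\delta\to 0$.
    have hδ : ∀ δ : ℝ, 0 < δ → 0 ≤ frobInner W H - δ * frobInner W (∑ j, h j) := by
      intro δ hδ
      have hmem : H - δ • ∑ j, h j ∈ S :=
        S.sub_mem hH (S.smul_mem _ (S.sum_mem fun j _ => hhS j))
      obtain ⟨Q, hQ⟩ := hS _ hmem
      have := hmin.frobInner_nonneg_of_neg hβ _ Q hQ fun i hi => ?_
      · simpa [frobInner_sub_right, frobInner_smul_right] using this
      · have h1 : frobInner (A i) (∑ j, h j) = 1 := by simp [frobInner_sum_right, hh]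
        rw [frobInner_sub_right, frobInner_smul_right, h1]
        linarith [hle i hi]
    have hev : ∀ᶠ δ in 𝓝[>] (0 : ℝ), 0 ≤ frobInner W H - δ * frobInner W (∑ j, h j) := by
      filter_upwards [self_mem_nhdsWithin] with δ hδ' using hδ δ hδ'
    refine ge_of_tendsto ?_ hev
    have hc : Continuous fun δ : ℝ => frobInner W H - δ * frobInner W (∑ j, h j) := by fun_prop
    simpa using hc.continuousAt.tendsto.mono_left (nhdsWithin_le_nhds (a := 0) (s := Set.Ioi 0))
  have hneg : ∀ j, frobInner W (h j) ≤ 0 := by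
    intro j
    have := hfirst (-h j) (S.neg_mem (hhS j)) fun i _ => ?_
    · rw [frobInner_neg_right] at this; linarith
    · rw [frobInner_neg_right, hh]; split_ifs <;> simp
  refine ⟨fun j => -frobInner W (h j), fun j => by linarith [hneg j], fun j hj => ?_,
    fun H hH => ?_⟩
  · have := hfirst (h j) (hhS j) fun i hi => ?_
    · linarith [hneg j]
    · rw [hh, if_neg (by rintro rfl; exact hj hi)]
  -- The part of `H` annihilated by all `A i` can be used with both signs, so `W` is orthogonal to
  -- it.
  · have hzero : ∀ i, frobInner (A i) (H - ∑ j, frobInner (A j) H • h j) = 0 := by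
      intro i
      simp [frobInner_sub_right, frobInner_sum_right, frobInner_smul_right, hh]
    have hmem : H - ∑ j, frobInner (A j) H • h j ∈ S :=
      S.sub_mem hH (S.sum_mem fun j _ => S.smul_mem _ (hhS j))
    have h1 := hfirst _ hmem fun i _ => (hzero i).le
    have h2 := hfirst _ (S.neg_mem hmem) fun i _ => by rw [frobInner_neg_right, hzero, neg_zero]
    rw [frobInner_neg_right] at h2
    have h3 : frobInner W (H - ∑ j, frobInner (A j) H • h j) = 0 := by linarith
    rw [frobInner_sub_right, frobInner_sum_right] at h3
    rw [frobInner_add_left, frobInner_sum_left, ← h3, sub_eq_add_neg, ← Finset.sum_neg_distrib]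
    congr 1
    refine Finset.sum_congr rfl fun j _ => ?_
    rw [frobInner_smul_left, frobInner_smul_right]
    ring

end FirstOrder

/-! ### Rank bounds and normals to the rank set. -/

section Rank

variable {n q : ℕ}

theorem rank_add_le (X Y : Matrix (Fin n) (Fin q) ℝ) : (X + Y).rank ≤ X.rank + Y.rank := by
  unfold Matrix.rank
  rw [Matrix.mulVecLin_add]
  exact (Submodule.finrank_mono (LinearMap.range_add_le _ _)).trans
    (Submodule.finrank_add_le_finrank_add_finrank _ _)

theorem rank_single_le (i : Fin n) (j : Fin q) (a : ℝ) : (Matrix.single i j a).rank ≤ 1 := by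
  have h : Matrix.single i j a = Matrix.vecMulVec (Pi.single i a) (Pi.single j 1) := by
    ext k l
    simp [Matrix.single_apply, Matrix.vecMulVec_apply, Pi.single_apply, ite_and, eq_comm]
    split_ifs <;> rfl
  rw [h]
  exact Matrix.rank_vecMulVec_le _ _

/-- A matrix whose rank is at most the size of an invertible compression `L * X * R` is recovered
from it. -/
theorem mul_inv_mul_eq_of_rank_le {ι : Type*} [Fintype ι] [DecidableEq ι]
    (X : Matrix (Fin n) (Fin q) ℝ) (L : Matrix ι (Fin n) ℝ) (R : Matrix (Fin q) ι ℝ)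
    (hdet : IsUnit (L * X * R).det) (hrank : X.rank ≤ Fintype.card ι) :
    X * R * (L * X * R)⁻¹ * (L * X) = X := by
  have h1 : Fintype.card ι ≤ (X * R).rank := by
    rw [← Matrix.rank_of_isUnit _ ((Matrix.isUnit_iff_isUnit_det _).2 hdet), Matrix.mul_assoc]
    exact Matrix.rank_mul_le_right _ _
  have hle : LinearMap.range (X * R).mulVecLin ≤ LinearMap.range X.mulVecLin := by
    rw [Matrix.mulVecLin_mul]
    exact LinearMap.range_comp_le_range _ _
  -- The rank bound forces `X * R` to have the whole column space of `X`, so each `X v` equals `X R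
  -- u`; then `u` is recovered from `L X v` by inverting `L * X * R`.
  have heq := Submodule.eq_of_le_of_finrank_le hle (hrank.trans h1)
  refine Matrix.toLin'.injective (LinearMap.ext fun v => ?_)
  obtain ⟨u, hu⟩ : X.mulVecLin v ∈ LinearMap.range (X * R).mulVecLin := heq ▸ ⟨v, rfl⟩
  simp only [Matrix.mulVecLin_apply] at hu
  simp only [Matrix.toLin'_apply]
  have h2 : (L * X).mulVec v = (L * X * R).mulVec u := by
    rw [← Matrix.mulVec_mulVec, ← hu, Matrix.mulVec_mulVec, Matrix.mul_assoc]
  rw [← Matrix.mulVec_mulVec, h2, Matrix.mulVec_mulVec, Matrix.mul_assoc,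
    Matrix.nonsing_inv_mul _ hdet, Matrix.mul_one, hu]

/-- A matrix `N` with `N * Wᵀ = 0` and `Wᵀ * N = 0` is normal at `W` to the matrices of rank at
most the size of an invertible compression of `W`. -/
theorem eventually_frobInner_sub_le {ι : Type*} [Fintype ι] [DecidableEq ι]
    {W N : Matrix (Fin n) (Fin q) ℝ} (L : Matrix ι (Fin n) ℝ) (R : Matrix (Fin q) ι ℝ)
    (hdet : IsUnit (L * W * R).det) (hN : N * W.transpose = 0) (hN' : W.transpose * N = 0)
    {ε : ℝ} (hε : 0 < ε) :
    ∀ᶠ X in 𝓝 W, X.rank ≤ Fintype.card ι →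
      frobInner N (X - W) ≤ ε * √(frobInner (X - W) (X - W)) := by
  set C : Matrix (Fin n) (Fin q) ℝ → Matrix ι ι ℝ := fun X => L * X * R with hC
  have hCc : Continuous C := by fun_prop
  set Z : Matrix (Fin n) (Fin q) ℝ → Matrix (Fin q) (Fin q) ℝ :=
    fun X => R * (C X)⁻¹ * (L * (X - W)) with hZ
  have hinv : ContinuousAt (fun X => (C X)⁻¹) W := by
    have h1 : ContinuousAt Ring.inverse (C W).det := by
      obtain ⟨u, hu⟩ := hdet
      rw [hC, ← hu]
      exact NormedRing.inverse_continuousAt u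
    exact ContinuousAt.comp (f := C) (continuousAt_matrix_inv _ h1) hCc.continuousAt
  have hZc : ContinuousAt Z W := by
    have h2 : Continuous fun p : Matrix ι ι ℝ × Matrix (Fin n) (Fin q) ℝ =>
        R * p.1 * (L * (p.2 - W)) := by fun_prop
    exact ContinuousAt.comp (f := fun X => ((C X)⁻¹, X)) h2.continuousAt
      (hinv.prodMk continuousAt_id)
  -- The factor `X - W` makes `Z` vanish at `W`.
  have hsmall : ∀ᶠ X in 𝓝 W, √(frobInner (N * (Z X).transpose) (N * (Z X).transpose)) < ε := by
    have hg : Continuous fun Y : Matrix (Fin q) (Fin q) ℝ =>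
        √(frobInner (N * Y.transpose) (N * Y.transpose)) := by
      have : Continuous fun Y : Matrix (Fin q) (Fin q) ℝ => N * Y.transpose := by fun_prop
      exact (continuous_frobInner this this).sqrt
    refine ContinuousAt.eventually_lt
      (ContinuousAt.comp (f := Z) hg.continuousAt hZc) continuousAt_const ?_
    simpa [hZ, frobInner] using hε
  have hunit : ∀ᶠ X in 𝓝 W, IsUnit (C X).det := by
    have : ∀ᶠ X in 𝓝 W, (C X).det ≠ 0 :=
      (hCc.matrix_det.continuousAt).eventually_ne hdet.ne_zero
    filter_upwards [this] with X hX using hX.isUnit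
  filter_upwards [hsmall, hunit] with X h1 h2 hrank
  have hX := mul_inv_mul_eq_of_rank_le X L R h2 hrank
  have hright : ∀ Y : Matrix (Fin n) (Fin n) ℝ, frobInner N (Y * W) = 0 := fun Y => by
    rw [frobInner_mul_right, hN]; simp [frobInner]
  have hleft : ∀ Y : Matrix (Fin q) (Fin q) ℝ, frobInner N (W * Y) = 0 := fun Y => by
    rw [frobInner_mul_right', hN']; simp [frobInner]
  -- This expands $X=XRC^{-1}LX$ around $W$. Terms with $W$ as an outer factor are orthogonal to
  -- $N$, leaving only the second-order term $(X-W)Z$.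
  have hdecomp : X = (X - W) * Z X + W * (R * (C X)⁻¹ * (L * (X - W)))
      + (X * R * (C X)⁻¹ * L) * W := by
    conv_lhs => rw [← hX]
    simp only [hZ, hC, Matrix.mul_sub, Matrix.sub_mul, Matrix.mul_assoc]
    abel
  have hkey : frobInner N (X - W) = frobInner (N * (Z X).transpose) (X - W) := by
    have hW : frobInner N W = 0 := by simpa using hleft 1
    rw [frobInner_sub_right, hW, sub_zero]
    conv_lhs => rw [hdecomp]
    rw [frobInner_add_right, frobInner_add_right, hleft, hright, add_zero, add_zero,
      frobInner_mul_right]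
  rw [hkey]
  exact (frobInner_le_sqrt_mul_sqrt _ _).trans
    (mul_le_mul_of_nonneg_right h1.le (Real.sqrt_nonneg _))

end Rank

/-! ### Thin singular value decomposition and the matrices $T$, $R$. -/

section SVD

variable {n q : ℕ} {W : Matrix (Fin n) (Fin q) ℝ} {U : Matrix (Fin n) (Fin n) ℝ}
  {σ : Fin (min n q) → ℝ} {V : Matrix (Fin q) (Fin q) ℝ}

theorem transpose_mul_submatrix_eq_one {ι κ : Type*} [Fintype ι] [DecidableEq ι] [DecidableEq κ]
    {Q : Matrix ι ι ℝ} (hQ : Q ∈ Matrix.orthogonalGroup ι ℝ) {f : κ → ι}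
    (hf : Function.Injective f) :
    (Q.submatrix id f).transpose * Q.submatrix id f = 1 := by
  have h : Q.transpose * Q = 1 := (Matrix.mem_orthogonalGroup_iff' _ _).1 hQ
  have h2 := congrArg (fun M : Matrix ι ι ℝ => M.submatrix f f) h
  simp only [Matrix.submatrix_one _ hf] at h2
  rw [← h2, Matrix.transpose_submatrix]
  rfl

theorem IsSVD.leftGam_orthonormal (h : IsSVD W U σ V) :
    (leftGam U σ).transpose * leftGam U σ = 1 :=
  transpose_mul_submatrix_eq_one h.orthogonal_left
    ((Fin.castLE_injective _).comp Subtype.val_injective)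

theorem IsSVD.rightGam_orthonormal (h : IsSVD W U σ V) :
    (rightGam V σ).transpose * rightGam V σ = 1 :=
  transpose_mul_submatrix_eq_one h.orthogonal_right
    ((Fin.castLE_injective _).comp Subtype.val_injective)

theorem rectDiagonal_eq_sum (σ : Fin (min n q) → ℝ) (i : Fin n) (j : Fin q) :
    rectDiagonal σ i j = ∑ k : Gam σ, (if i = Fin.castLE (min_le_left n q) k.1 then 1 else 0) *
      σ k.1 * (if j = Fin.castLE (min_le_right n q) k.1 then 1 else 0) := by
  let F : Fin (min n q) → ℝ := fun k => (if i = Fin.castLE (min_le_left n q) k then 1 else 0) *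
    σ k * (if j = Fin.castLE (min_le_right n q) k then 1 else 0)
  have hsub : ∑ k : Gam σ, F k.1 = ∑ k, F k := by
    classical
    rw [← Finset.sum_filter_of_ne (p := fun k => σ k ≠ 0) fun k _ hk h0 => hk (by simp [F, h0])]
    exact (Finset.sum_subtype _ (by simp) F).symm
  change _ = ∑ k : Gam σ, F k.1
  rw [hsub]
  simp only [rectDiagonal, Matrix.of_apply, F]
  split_ifs with h
  · rw [Finset.sum_eq_single ⟨i, lt_min i.isLt (lt_of_eq_of_lt h j.isLt)⟩]
    · simp [Fin.ext_iff, h]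
    · intro k _ hk
      rw [if_neg, zero_mul, zero_mul]
      rintro rfl
      exact hk rfl
    · simp
  · refine (Finset.sum_eq_zero fun k _ => ?_).symm
    by_cases hi : i = Fin.castLE (min_le_left n q) k
    · rw [if_neg (c := j = _), mul_zero]
      rintro rfl
      exact h (by simp [hi])
    · rw [if_neg hi, zero_mul, zero_mul]

/-- The thin singular value decomposition. -/
theorem IsSVD.eq_thin (h : IsSVD W U σ V) :
    W = leftGam U σ * Matrix.diagonal (fun k : Gam σ => σ k.1) * (rightGam V σ).transpose := by
  have hdiag : rectDiagonal σ = leftGam (1 : Matrix (Fin n) (Fin n) ℝ) σ *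
      Matrix.diagonal (fun k : Gam σ => σ k.1) *
      (rightGam (1 : Matrix (Fin q) (Fin q) ℝ) σ).transpose := by
    ext i j
    rw [rectDiagonal_eq_sum, Matrix.mul_apply]
    simp only [Matrix.mul_diagonal, leftGam, rightGam, Matrix.submatrix_apply,
      Matrix.transpose_apply, Matrix.one_apply, id]
  have hl : U * leftGam (1 : Matrix (Fin n) (Fin n) ℝ) σ = leftGam U σ := by
    ext i k
    simp [leftGam, Matrix.mul_apply, Matrix.one_apply]
  have hr : V * rightGam (1 : Matrix (Fin q) (Fin q) ℝ) σ = rightGam V σ := by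
    ext i k
    simp [rightGam, Matrix.mul_apply, Matrix.one_apply]
  conv_lhs => rw [h.eq_mul, hdiag]
  rw [← hl, ← hr, Matrix.transpose_mul]
  simp only [Matrix.mul_assoc]

theorem isUnit_det_diagonal_gam (σ : Fin (min n q) → ℝ) :
    IsUnit (Matrix.diagonal (fun k : Gam σ => σ k.1)).det := by
  rw [Matrix.det_diagonal]
  exact (Finset.prod_ne_zero_iff.2 fun k _ => k.2).isUnit

theorem IsSVD.compression_eq (h : IsSVD W U σ V) :
    (leftGam U σ).transpose * W * rightGam V σ = Matrix.diagonal (fun k : Gam σ => σ k.1) := by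
  conv_lhs => rw [h.eq_thin]
  calc _ = ((leftGam U σ).transpose * leftGam U σ) * Matrix.diagonal (fun k : Gam σ => σ k.1) *
        ((rightGam V σ).transpose * rightGam V σ) := by simp only [Matrix.mul_assoc]
    _ = _ := by rw [h.leftGam_orthonormal, h.rightGam_orthonormal, Matrix.one_mul, Matrix.mul_one]

theorem IsSVD.rank_le (h : IsSVD W U σ V) : W.rank ≤ Fintype.card (Gam σ) := by
  rw [h.eq_thin, Matrix.mul_assoc]
  exact (Matrix.rank_mul_le_left _ _).trans (Matrix.rank_le_card_width _)

/-- From $W^\top U_\Gamma=V_\Gamma\Sigma_\Gamma$ with $\Sigma_\Gamma$ invertible, the columns of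
$V_\Gamma$ lie in the range of $W^\top$. -/
theorem IsSVD.mul_rightGam_eq_zero (h : IsSVD W U σ V) {B : Matrix (Fin n) (Fin q) ℝ}
    (hB : B * W.transpose = 0) : B * rightGam V σ = 0 := by
  have h1 : W.transpose * leftGam U σ =
      rightGam V σ * Matrix.diagonal (fun k : Gam σ => σ k.1) := by
    conv_lhs => rw [h.eq_thin]
    simp only [Matrix.transpose_mul, Matrix.transpose_transpose, Matrix.diagonal_transpose,
      Matrix.mul_assoc, h.leftGam_orthonormal, Matrix.mul_one]
  have h2 : B * rightGam V σ * Matrix.diagonal (fun k : Gam σ => σ k.1) = 0 := by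
    rw [Matrix.mul_assoc, ← h1, ← Matrix.mul_assoc, hB, Matrix.zero_mul]
  have h3 := congrArg (· * (Matrix.diagonal (fun k : Gam σ => σ k.1))⁻¹) h2
  simpa [Matrix.mul_assoc, Matrix.mul_nonsing_inv _ (isUnit_det_diagonal_gam σ)] using h3

theorem IsSVD.leftGam_transpose_mul_eq_zero (h : IsSVD W U σ V) {B : Matrix (Fin n) (Fin q) ℝ}
    (hB : W.transpose * B = 0) : (leftGam U σ).transpose * B = 0 := by
  have h1 : (rightGam V σ).transpose * W.transpose =
      Matrix.diagonal (fun k : Gam σ => σ k.1) * (leftGam U σ).transpose := by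
    conv_lhs => rw [h.eq_thin]
    simp only [Matrix.transpose_mul, Matrix.transpose_transpose, Matrix.diagonal_transpose,
      ← Matrix.mul_assoc, h.rightGam_orthonormal, Matrix.one_mul]
  have h2 : Matrix.diagonal (fun k : Gam σ => σ k.1) * ((leftGam U σ).transpose * B) = 0 := by
    rw [← Matrix.mul_assoc, ← h1, Matrix.mul_assoc, hB, Matrix.mul_zero]
  have h3 := congrArg ((Matrix.diagonal (fun k : Gam σ => σ k.1))⁻¹ * ·) h2
  simpa [← Matrix.mul_assoc, Matrix.nonsing_inv_mul _ (isUnit_det_diagonal_gam σ)] using h3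

theorem matT_sum_smul {m : ℕ} (A : Fin m → Matrix (Fin n) (Fin q) ℝ) (c : Fin m → ℝ) :
    ∑ i, c i • matT U σ V (A i) = matT U σ V (∑ i, c i • A i) := by
  let L : Matrix (Fin n) (Fin q) ℝ →ₗ[ℝ]
      Matrix (Gam σ ⊕ GamRowCompl σ) (Gam σ ⊕ GamColCompl σ) ℝ :=
    { toFun := matT U σ V
      map_add' := fun X Y => by
        simp [matT, Matrix.fromBlocks_add, Matrix.mul_add, Matrix.add_mul]
      map_smul' := fun t X => by simp [matT, Matrix.fromBlocks_smul] }
  exact (Eq.symm <| (map_sum L _ _).trans <| Finset.sum_congr rfl fun i _ => map_smul L _ _)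

theorem matR_sum_smul {m : ℕ} (A : Fin m → Matrix (Fin n) (Fin q) ℝ) (c : Fin m → ℝ) :
    ∑ i, c i • matR U σ V (A i) = matR U σ V (∑ i, c i • A i) := by
  simp [matR, Matrix.mul_sum, Matrix.sum_mul]

/-- Each block other than the prescribed zero block contains $U_\Gamma^\top B$ or $BV_\Gamma$. This
converts independence of the $T^i$ into independence on the directions $XW+WY$. -/
theorem IsSVD.matT_eq_zero (h : IsSVD W U σ V) {B : Matrix (Fin n) (Fin q) ℝ}
    (hB : B * W.transpose = 0) (hB' : W.transpose * B = 0) : matT U σ V B = 0 := by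
  simp [matT, h.leftGam_transpose_mul_eq_zero hB', Matrix.mul_assoc,
    h.mul_rightGam_eq_zero hB]

theorem IsSVD.matR_eq_zero (h : IsSVD W U σ V) {B : Matrix (Fin n) (Fin q) ℝ}
    (hB : B * W.transpose = 0) : matR U σ V B = 0 := by
  rw [matR, Matrix.mul_assoc, h.mul_rightGam_eq_zero hB, Matrix.mul_zero]

end SVD

/-! ### Subgradients, normality and the two rank cases. -/

section KKT

variable {n q m r : ℕ} {A : Fin m → Matrix (Fin n) (Fin q) ℝ} {β : ℝ}
  {W : Matrix (Fin n) (Fin q) ℝ} {z : Fin m → ℝ}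

theorem eq_zero_of_frobInner_mul_eq_zero {B : Matrix (Fin n) (Fin q) ℝ}
    (h : ∀ X : Matrix (Fin n) (Fin n) ℝ, frobInner B (X * W) = 0) : B * W.transpose = 0 :=
  eq_zero_of_forall_frobInner_eq_zero fun X => by rw [← frobInner_mul_right, h]

theorem eq_zero_of_frobInner_mul_eq_zero' {B : Matrix (Fin n) (Fin q) ℝ}
    (h : ∀ Y : Matrix (Fin q) (Fin q) ℝ, frobInner B (W * Y) = 0) : W.transpose * B = 0 :=
  eq_zero_of_forall_frobInner_eq_zero fun X => by rw [← frobInner_mul_right', h]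

theorem dotProduct_opA (s : Fin m → ℝ) (X : Matrix (Fin n) (Fin q) ℝ) :
    s ⬝ᵥ opA A X = frobInner (∑ i, s i • A i) X := by
  simp [dotProduct, opA, frobInner_sum_left, frobInner_smul_left]

/-- `s` is a regular subgradient of `β‖·₊‖₀` at `z`. -/
theorem eventually_heavisideLoss_ge (hβ : 0 < β) {s : Fin m → ℝ} (hs : ∀ i, 0 ≤ s i)
    (hsz : ∀ i, z i ≠ 0 → s i = 0) :
    ∀ᶠ y in 𝓝 z, β * heavisideLoss z + s ⬝ᵥ (y - z) ≤ β * heavisideLoss y := by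
  have hi : ∀ᶠ y in 𝓝 z, ∀ i, β * ell01 (z i) + s i * (y i - z i) ≤ β * ell01 (y i) := by
    refine Filter.eventually_all.2 fun i => ?_
    refine ((continuous_apply i).tendsto z).eventually
      (p := fun t => β * ell01 (z i) + s i * (t - z i) ≤ β * ell01 t) ?_
    rcases lt_trichotomy (z i) 0 with h | h | h
    · filter_upwards [eventually_lt_nhds h] with t ht
      simp [ell01_of_nonpos h.le, ell01_of_nonpos ht.le, hsz i h.ne]
    · have hc : Continuous fun t : ℝ => s i * t := by fun_prop
      -- At a zero entry, the jump of height `β` dominates any linear function for small positive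
      -- `t`; for `t ≤ 0` the sign of `s i` suffices.
      have : ∀ᶠ t in 𝓝 (z i), s i * t < β :=
        hc.continuousAt.eventually_lt continuousAt_const (by simpa [h] using hβ)
      filter_upwards [this] with t ht
      rw [h, ell01_of_nonpos le_rfl]
      rcases le_or_gt t 0 with h' | h'
      · rw [ell01_of_nonpos h']
        linarith [mul_nonpos_of_nonneg_of_nonpos (hs i) h']
      · rw [ell01_of_pos h']
        linarith
    · filter_upwards [eventually_gt_nhds h] with t ht
      simp [ell01_of_pos h, ell01_of_pos ht, hsz i h.ne']
  filter_upwards [hi] with y hy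
  simp only [heavisideLoss, Finset.mul_sum, dotProduct, Pi.sub_apply, ← Finset.sum_add_distrib]
  exact Finset.sum_le_sum fun i _ => hy i

/-- The first-order remainder is $\tfrac12\|Y-W\|^2$, with $Y$ the matrix part of the nearby point,
plus the remainder of the loss against its subgradient $s$. Both are nonnegative near the point, so
the $\varepsilon$ term is mere slack. -/
theorem mem_regularSubdifferential_lagrangian (hβ : 0 < β) {s : Fin m → ℝ} (hs : ∀ i, 0 ≤ s i)
    (hsz : ∀ i, z i ≠ 0 → s i = 0) :
    (W + ∑ i, s i • A i, 0) ∈ regularSubdifferential (lagrangian A β s) (W, z) := by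
  intro ε hε
  have h := (continuous_snd.tendsto (W, z)).eventually
    (eventually_heavisideLoss_ge hβ hs hsz)
  filter_upwards [h] with y hy
  have h1 : 0 ≤ ε * pairNorm (y - (W, z)) := mul_nonneg hε.le (Real.sqrt_nonneg _)
  have h2 := frobInner_self_nonneg (y.1 - W)
  simp only [lagrangian, pairInner, dotProduct_sub, dotProduct_add, dotProduct_opA, Prod.fst_sub,
    zero_dotProduct, frobInner_sub_right, frobInner_add_left] at hy ⊢
  rw [frobInner_sub_right, frobInner_comm _ y.1, frobInner_comm _ W, frobInner_sub_right,
    frobInner_sub_right, frobInner_comm y.1 W] at h2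
  linarith

/-- As the $z$-component of the subgradient is zero, only matrix displacements are tested, and the
rank bound is all that is used of nearby feasible points. -/
theorem isKKTPoint_of_multiplier (hβ : 0 < β) (hfeas : (W, z) ∈ feasibleSet A r) {s : Fin m → ℝ}
    (hs : ∀ i, 0 ≤ s i) (hsz : ∀ i, z i ≠ 0 → s i = 0)
    (hnormal : ∀ ε : ℝ, 0 < ε → ∀ᶠ X in 𝓝 W, X.rank ≤ r →
      frobInner (-(W + ∑ i, s i • A i)) (X - W) ≤ ε * √(frobInner (X - W) (X - W))) :
    IsKKTPoint A β r (W, z) := by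
  refine ⟨s, ⟨_, mem_regularSubdifferential_lagrangian hβ hs hsz, hfeas, fun ε hε => ?_⟩,
    hfeas.2, sub_eq_zero.2 hfeas.1⟩
  have h := (continuous_fst.tendsto (W, z)).eventually (hnormal ε hε)
  filter_upwards [nhdsWithin_le_nhds h, self_mem_nhdsWithin] with y hy hyF
  have h1 := (hy hyF.2).trans
    (mul_le_mul_of_nonneg_left (sqrt_frobInner_le_pairNorm (y - (W, z))) hε.le)
  simpa [pairInner] using h1

/-- At full rank the tangent directions are `X * W + W * Y`. -/
theorem IsLocalMinimizer.isKKTPoint_of_rank_eq {U : Matrix (Fin n) (Fin n) ℝ}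
    {σ : Fin (min n q) → ℝ} {V : Matrix (Fin q) (Fin q) ℝ} (hβ : 0 < β)
    (hmin : IsLocalMinimizer A β r (W, z)) (hsvd : IsSVD W U σ V) (hrank : W.rank = r)
    (hT : LinearIndependent ℝ fun i => matT U σ V (A i)) : IsKKTPoint A β r (W, z) := by
  let S : Submodule ℝ (Matrix (Fin n) (Fin q) ℝ) :=
    LinearMap.range (mulRightLinearMap (Fin n) ℝ W) ⊔ LinearMap.range (mulLeftLinearMap (Fin q) ℝ W)
  have hmul : ∀ X : Matrix (Fin n) (Fin n) ℝ, X * W ∈ S :=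
    fun X => Submodule.mem_sup_left ⟨X, rfl⟩
  have hmul' : ∀ Y : Matrix (Fin q) (Fin q) ℝ, W * Y ∈ S :=
    fun Y => Submodule.mem_sup_right ⟨Y, rfl⟩
  obtain ⟨s, hs, hsz, hS⟩ : ∃ s : Fin m → ℝ, (∀ i, 0 ≤ s i) ∧ (∀ i, z i ≠ 0 → s i = 0) ∧
      ∀ H ∈ S, frobInner (W + ∑ i, s i • A i) H = 0 := by
    refine hmin.exists_multiplier hβ S ?_ ?_
    · intro H hH
      obtain ⟨_, ⟨X, rfl⟩, _, ⟨Y, rfl⟩, rfl⟩ := Submodule.mem_sup.1 hH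
      -- This quadratic term completes the curve to $(1+tX)W(1+tY)$, whose rank never exceeds that
      -- of $W$.
      refine ⟨X * W * Y, fun t => ?_⟩
      have : W + t • (X * W + W * Y) + t ^ 2 • (X * W * Y) = (1 + t • X) * W * (1 + t • Y) := by
        simp only [Matrix.add_mul, Matrix.mul_add, Matrix.one_mul, Matrix.mul_one, Matrix.smul_mul,
          Matrix.mul_smul, smul_add, smul_smul, pow_two]
        abel
      change (W + t • (X * W + W * Y) + t ^ 2 • (X * W * Y)).rank ≤ r
      rw [this, ← hrank]
      exact (Matrix.rank_mul_le_left _ _).trans (Matrix.rank_mul_le_right _ _)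
    · intro c hc
      refine funext (Fintype.linearIndependent_iff.1 hT c ?_)
      rw [matT_sum_smul]
      exact hsvd.matT_eq_zero (eq_zero_of_frobInner_mul_eq_zero fun X => hc _ (hmul X))
        (eq_zero_of_frobInner_mul_eq_zero' fun X => hc _ (hmul' X))
  refine isKKTPoint_of_multiplier hβ hmin.1 hs hsz fun ε hε => ?_
  have hN : -(W + ∑ i, s i • A i) * W.transpose = 0 :=
    eq_zero_of_frobInner_mul_eq_zero fun X => by
      rw [frobInner_neg_left, hS _ (hmul X), neg_zero]
  have hN' : W.transpose * -(W + ∑ i, s i • A i) = 0 :=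
    eq_zero_of_frobInner_mul_eq_zero' fun X => by
      rw [frobInner_neg_left, hS _ (hmul' X), neg_zero]
  filter_upwards [eventually_frobInner_sub_le (leftGam U σ).transpose (rightGam V σ)
    (hsvd.compression_eq ▸ isUnit_det_diagonal_gam σ) hN hN' hε] with X hX hXr
  exact hX (hXr.trans (hrank ▸ hsvd.rank_le))

/-- Below full rank the directions `X * W + a • E i j` are tangent, and the multipliers are
determined by the `X * W`. -/
theorem IsLocalMinimizer.isKKTPoint_of_rank_lt {U : Matrix (Fin n) (Fin n) ℝ}
    {σ : Fin (min n q) → ℝ} {V : Matrix (Fin q) (Fin q) ℝ} (hβ : 0 < β)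
    (hmin : IsLocalMinimizer A β r (W, z)) (hsvd : IsSVD W U σ V) (hrank : W.rank < r)
    (hR : LinearIndependent ℝ fun i => matR U σ V (A i)) : IsKKTPoint A β r (W, z) := by
  let S : Submodule ℝ (Matrix (Fin n) (Fin q) ℝ) := LinearMap.range (mulRightLinearMap (Fin n) ℝ W)
  have hmul : ∀ X : Matrix (Fin n) (Fin n) ℝ, X * W ∈ S := fun X => ⟨X, rfl⟩
  have hind : ∀ c : Fin m → ℝ, (∀ H ∈ S, frobInner (∑ i, c i • A i) H = 0) → c = 0 := by
    intro c hc
    refine funext (Fintype.linearIndependent_iff.1 hR c ?_)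
    rw [matR_sum_smul]
    exact hsvd.matR_eq_zero (eq_zero_of_frobInner_mul_eq_zero fun X => hc _ (hmul X))
  have hex : ∀ K : Matrix (Fin n) (Fin q) ℝ, K.rank ≤ 1 → ∃ s : Fin m → ℝ, (∀ i, 0 ≤ s i) ∧
      (∀ i, z i ≠ 0 → s i = 0) ∧ ∀ H ∈ S ⊔ ℝ ∙ K, frobInner (W + ∑ i, s i • A i) H = 0 := by
    intro K hK
    -- A straight line suffices: $(1+tX)W+taK$ has rank at most $\operatorname{rank} W+1\le r$.
    refine hmin.exists_multiplier hβ _ (fun H hH => ⟨0, fun t => ?_⟩)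
      fun c hc => hind c fun H hH => hc H (Submodule.mem_sup_left hH)
    obtain ⟨_, ⟨X, rfl⟩, K', hK', rfl⟩ := Submodule.mem_sup.1 hH
    obtain ⟨a, rfl⟩ := Submodule.mem_span_singleton.1 hK'
    have : W + t • (X * W + a • K) + t ^ 2 • 0 =
        (1 + t • X) * W + K * (t * a) • (1 : Matrix (Fin q) (Fin q) ℝ) := by
      simp [Matrix.add_mul, smul_smul, add_assoc]
    change (W + t • (X * W + a • K) + t ^ 2 • 0).rank ≤ r
    rw [this]
    have h1 := rank_add_le ((1 + t • X) * W) (K * (t * a) • (1 : Matrix (Fin q) (Fin q) ℝ))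
    have h2 := Matrix.rank_mul_le_right (1 + t • X) W
    have h3 := Matrix.rank_mul_le_left K ((t * a) • (1 : Matrix (Fin q) (Fin q) ℝ))
    omega
  obtain ⟨s, hs, hsz, hS⟩ := hex 0 (by simp)
  have hN : W + ∑ i, s i • A i = 0 := by
    ext i j
    -- The multipliers for this direction agree with `s`, both being determined on `S`; pairing with
    -- the matrix unit then isolates one entry.
    obtain ⟨s', -, -, hS'⟩ := hex (Matrix.single i j 1) (rank_single_le i j 1)
    have hss : s' - s = 0 := hind _ fun H hH => by
      have h1 := hS _ (Submodule.mem_sup_left hH)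
      have h2 := hS' _ (Submodule.mem_sup_left hH)
      rw [frobInner_add_left] at h1 h2
      simp only [Pi.sub_apply, sub_smul, Finset.sum_sub_distrib]
      rw [sub_eq_add_neg, frobInner_add_left, frobInner_neg_left]
      linarith
    have h3 := hS' _ (Submodule.mem_sup_right (Submodule.mem_span_singleton_self _))
    rwa [frobInner_single_right, sub_eq_zero.1 hss] at h3
  refine isKKTPoint_of_multiplier hβ hmin.1 hs hsz fun ε hε => .of_forall fun X _ => ?_
  rw [hN]
  simpa [frobInner] using mul_nonneg hε.le (Real.sqrt_nonneg _)

end KKT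

end HLSMM

theorem mainTheorem1 (p q m r : ℕ) (hr : 0 < r) (hrpq : r < min p q)
    (A : Fin m → Matrix (Fin (p + 1)) (Fin q) ℝ) (β : ℝ) (hβ : 0 < β)
    (W : Matrix (Fin (p + 1)) (Fin q) ℝ) (z : Fin m → ℝ)
    (U : Matrix (Fin (p + 1)) (Fin (p + 1)) ℝ) (σ : Fin (min (p + 1) q) → ℝ)
    (V : Matrix (Fin q) (Fin q) ℝ) (hsvd : HLSMM.IsSVD W U σ V)
    (hcq : HLSMM.ConstraintQualification A r W U σ V)
    (hmin : HLSMM.IsLocalMinimizer A β r (W, z)) :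
    HLSMM.IsKKTPoint A β r (W, z) := by
  have hrank : W.rank ≤ r := hmin.1.2
  rcases hrank.eq_or_lt with h | h
  · exact hmin.isKKTPoint_of_rank_eq hβ hsvd h (hcq.1 h)
  · exact hmin.isKKTPoint_of_rank_lt hβ hsvd h (hcq.2 h)
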